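/- (Necessity of the physical damping $B_f$ and of the virtual damping $b_{22}$.) Let $M,B,K_f,P_m,P_f,k_{22}>0$, $B_f,I_m,I_f,b_{22}\ge 0$, $0\le\alpha\le 1$, and put $\mu=I_m/P_m$, $\nu=I_f/P_f$. Series damped elastic actuation (SDEA) under velocity-sourced impedance control (VSIC) with the virtual coupler is the two-port with hybrid matrix $$H(s)=\begin{bmatrix}h_{11}&h_{12}\\-1&h_{22}\end{bmatrix},\qquad h_{11}=\frac{N_{11}}{D},\quad h_{12}=\frac{N_{12}}{D},\quad h_{22}=\frac{s}{b_{22}s+k_{22}},$$ where $$D=Ms^4+(B+P_m+B_f(\alpha+P_mP_f))s^3+(I_m+K_f(\alpha+P_mP_f)+B_fP_mP_f(\mu+\nu))s^2+(B_fI_mI_f+K_fP_mP_f(\mu+\nu))s+K_fI_mI_f,$$ $$N_{11}=B_fMs^4+(B_f(B+P_m)+K_fM)s^3+(B_fI_m+K_f(B+P_m))s^2+K_fI_ms,$$ $$N_{12}=B_fP_mP_fs^3+P_mP_f(K_f+B_f(\mu+\nu))s^2+(B_fI_mI_f+K_fP_mP_f(\mu+\nu))s+K_fI_mI_f.$$ A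 real-rational $H$ is two-port passive (positive real) if it has no poles in $\operatorname{Re}s>0$ and $\operatorname{Re}(x^*H(s)x)\ge 0$ for all $x\in\mathbb C^2$ and all $s$ with $\operatorname{Re}s>0$. The passivity criterion on the $h$-parameters asks that (a) they have no poles in $\operatorname{Re}s>0$; (b) their poles on the imaginary axis are simple with real positive residues; and, at all $s=j\omega$ that are not poles, (c-i) $\operatorname{Re}h_{11}\ge0$ and $\operatorname{Re}h_{22}\ge0$, and (c-ii) $c(\omega):=\operatorname{Re}h_{11}\operatorname{Re}h_{22}-\left|\tfrac{h_{12}^*+h_{21}}{2}\right|^2\ge0$, where $h_{21}=-1$. The frequency polynomial of Condition (c-ii) is $$t(x)=(4B_f-b_{22})b_{22}M^2x^5+(4b_{22}r_2+b_{22}^2\tau_2-k_{22}^2M^2)x^4+(4b_{22}r_1+k_{22}^2\tau_2-b_{22}^2(I_m+\alpha K_f)^2)x^3+(4b_{22}K_f^2I_m\kappa_1-k_{22}^2(I_m+\alpha K_f)^2)x^2,$$ with $\kappa_1=P_fI_m-BI_f$, $\kappa_3=\alpha(B+P_m)+P_mP_f(B+P_m-M(\mu+\nu))$, $\tau_2=2M(I_m+\alpha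 K_f)-(B+P_m+\alpha B_f)^2$, $r_1=K_f^2\kappa_3+B_fI_m^2+B_f^2I_m\kappa_1$, $r_2=B_f\big((B+P_m)^2+B_f\kappa_3-2I_mM\big)$. Then: 1. If $B_f=0$ (pure SEA) or $b_{22}=0$ (coupler with no damping), then $H$ is not two-port passive and does not satisfy the passivity criterion; more precisely, for all sufficiently large $\omega$, $j\omega$ is not a pole of any $h$-parameter and $c(\omega)<0$, so that Condition (c-ii) fails. 2. $t(\omega^2)=4\,|D(j\omega)|^2\,|b_{22}j\omega+k_{22}|^2\,c(\omega)$ for every real $\omega$ with $D(j\omega)\ne0$. 3. If $B_f=0$, the coefficient of $x^5$ in $t$ is $-b_{22}^2M^2$; if moreover $b_{22}>0$, then $t$ has degree $5$ and its leading coefficient $-b_{22}^2M^2$ is negative. 4. If $b_{22}=0$, then $t$ has degree $4$ and its leading coefficient $-k_{22}^2M^2$ is negative. -/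

import Mathlib

open Polynomial

noncomputable section

namespace SDEA

/-! ### Real-rational transfer functions and two-port passivity -/

/-- Value of a real-rational transfer function at the complex frequency `s`
(meaningful when `s` is not a pole; numerator and denominator are coprime). -/
def tfEval (f : RatFunc ℝ) (s : ℂ) : ℂ := RatFunc.eval Complex.ofRealHom s f

/-- `s` is a pole of `f`, i.e. a root of the reduced denominator. -/
def IsPole (f : RatFunc ℝ) (s : ℂ) : Prop := aeval s f.denom = 0

/-- `s` is a simple pole of `f`. -/
def IsSimplePole (f : RatFunc ℝ) (s : ℂ) : Prop :=
  IsPole f s ∧ aeval s (derivative f.denom) ≠ 0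

/-- The residue of `f` at a simple pole `s`. -/
def simpleResidue (f : RatFunc ℝ) (s : ℂ) : ℂ :=
  aeval s f.num / aeval s (derivative f.denom)

/-- The point `jω` of the imaginary axis. -/
def jw (ω : ℝ) : ℂ := Complex.I * (ω : ℂ)

/-- The left-hand side `Re h₁₁ · Re h₂₂ - |(h₁₂* + h₂₁) / 2|²` of Condition (c-ii) at
frequency `ω`. -/
def condCii (H : Matrix (Fin 2) (Fin 2) (RatFunc ℝ)) (ω : ℝ) : ℝ :=
  (tfEval (H 0 0) (jw ω)).re * (tfEval (H 1 1) (jw ω)).re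
    - ‖((starRingEnd ℂ) (tfEval (H 0 1) (jw ω)) + tfEval (H 1 0) (jw ω)) / 2‖ ^ 2

/-- Frequency-domain passivity of the linear time-invariant two-port with hybrid matrix `H`:
`H` is a positive real matrix, i.e. it has no pole in the open right half plane, and for every
`s` there and all complex amplitudes `x = (v₁, F₂)` the absorbed power
`Re (x* H(s) x) = Re (F₁ v₁* + v₂ F₂*)` is nonnegative. -/
def TwoPortPassive (H : Matrix (Fin 2) (Fin 2) (RatFunc ℝ)) : Prop :=
  (∀ i j, ∀ s : ℂ, 0 < s.re → ¬ IsPole (H i j) s) ∧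
  (∀ s : ℂ, 0 < s.re → ∀ x : Fin 2 → ℂ,
    0 ≤ (∑ i, ∑ j, (starRingEnd ℂ) (x i) * tfEval (H i j) s * x j).re)

/-- The two-port passivity criterion on the h-parameters, Conditions (a), (b), (c-i), (c-ii).
Condition (c) is imposed at every frequency at which all four h-parameters are finite. -/
structure TwoPortPassivityCriterion (H : Matrix (Fin 2) (Fin 2) (RatFunc ℝ)) : Prop where
  condA : ∀ i j, ∀ s : ℂ, 0 < s.re → ¬ IsPole (H i j) s
  condB : ∀ i j, ∀ ω : ℝ, IsPole (H i j) (jw ω) →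
    IsSimplePole (H i j) (jw ω) ∧ ∃ r : ℝ, 0 < r ∧ simpleResidue (H i j) (jw ω) = (r : ℂ)
  condCi : ∀ ω : ℝ, (∀ i j, ¬ IsPole (H i j) (jw ω)) →
    0 ≤ (tfEval (H 0 0) (jw ω)).re ∧ 0 ≤ (tfEval (H 1 1) (jw ω)).re
  condCii : ∀ ω : ℝ, (∀ i j, ¬ IsPole (H i j) (jw ω)) → 0 ≤ condCii H ω

/-! ### Series damped elastic actuation under velocity-sourced impedance control -/

/-- Parameters of the plant (`M`, `B`, `Kf`, `Bf`), of the two PI controllers (`Pm`, `Im` for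
motion, `Pf`, `If` for force), of the feed-forward action (`α`), and of the virtual coupler
(`k22`, `b22`). -/
structure Params where
  M : ℝ
  B : ℝ
  Kf : ℝ
  Bf : ℝ
  Pm : ℝ
  Im : ℝ
  Pf : ℝ
  If : ℝ
  α : ℝ
  k22 : ℝ
  b22 : ℝ

namespace Params

variable (p : Params)

/-- Physical range of the parameters. -/
structure Admissible : Prop where
  M_pos : 0 < p.M
  B_pos : 0 < p.B
  Kf_pos : 0 < p.Kf
  Pm_pos : 0 < p.Pm
  Pf_pos : 0 < p.Pf
  k22_pos : 0 < p.k22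
  Bf_nonneg : 0 ≤ p.Bf
  Im_nonneg : 0 ≤ p.Im
  If_nonneg : 0 ≤ p.If
  b22_nonneg : 0 ≤ p.b22
  α_nonneg : 0 ≤ p.α
  α_le_one : p.α ≤ 1

def μ : ℝ := p.Im / p.Pm

def ν : ℝ := p.If / p.Pf

/-- Common denominator `a₄ s⁴ + a₃ s³ + a₂ s² + a₁ s + a₀` of `h₁₁` and `h₁₂`. -/
def den : ℝ[X] :=
  C p.M * X ^ 4
    + C (p.B + p.Pm + p.Bf * (p.α + p.Pm * p.Pf)) * X ^ 3
    + C (p.Im + p.Kf * (p.α + p.Pm * p.Pf) + p.Bf * p.Pm * p.Pf * (p.μ + p.ν)) * X ^ 2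
    + C (p.Bf * p.Im * p.If + p.Kf * p.Pm * p.Pf * (p.μ + p.ν)) * X
    + C (p.Kf * p.Im * p.If)

def num11 : ℝ[X] :=
  C (p.Bf * p.M) * X ^ 4
    + C (p.Bf * (p.B + p.Pm) + p.Kf * p.M) * X ^ 3
    + C (p.Bf * p.Im + p.Kf * (p.B + p.Pm)) * X ^ 2
    + C (p.Kf * p.Im) * X

def num12 : ℝ[X] :=
  C (p.Bf * p.Pm * p.Pf) * X ^ 3
    + C (p.Pm * p.Pf * (p.Kf + p.Bf * (p.μ + p.ν))) * X ^ 2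
    + C (p.Bf * p.Im * p.If + p.Kf * p.Pm * p.Pf * (p.μ + p.ν)) * X
    + C (p.Kf * p.Im * p.If)

/-- Denominator `b₂₂ s + k₂₂` of the virtual coupler. -/
def den22 : ℝ[X] := C p.b22 * X + C p.k22

/-- The transfer function `N / D`. -/
def tf (N D : ℝ[X]) : RatFunc ℝ := algebraMap ℝ[X] (RatFunc ℝ) N / algebraMap ℝ[X] (RatFunc ℝ) D

/-- Hybrid matrix, from `(-v_h, F_e)` to `(F_int, v_e)`, of the actuator under velocity-sourced
impedance control with the virtual coupler. -/
def hybrid : Matrix (Fin 2) (Fin 2) (RatFunc ℝ) :=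
  !![tf p.num11 p.den, tf p.num12 p.den;
     -1,               tf X p.den22]

def κ₁ : ℝ := p.Pf * p.Im - p.B * p.If

def κ₂ : ℝ := p.B + p.Pm - p.M * (p.μ + p.ν)

def κ₃ : ℝ := p.α * (p.B + p.Pm) + p.Pm * p.Pf * p.κ₂

def τ₁ : ℝ := 4 * p.Bf - p.b22

def τ₂ : ℝ := 2 * p.M * (p.Im + p.α * p.Kf) - (p.B + p.Pm + p.α * p.Bf) ^ 2

def r₁ : ℝ := p.Kf ^ 2 * p.κ₃ + p.Bf * p.Im ^ 2 + p.Bf ^ 2 * p.Im * p.κ₁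

def r₂ : ℝ := p.Bf * ((p.B + p.Pm) ^ 2 + p.Bf * p.κ₃ - 2 * p.Im * p.M)

/-- The frequency polynomial of Condition (c-ii), in the variable `x = ω²`. -/
def freqPoly : ℝ[X] :=
  C (p.τ₁ * p.b22 * p.M ^ 2) * X ^ 5
    + C (4 * p.b22 * p.r₂ + p.b22 ^ 2 * p.τ₂ - p.k22 ^ 2 * p.M ^ 2) * X ^ 4
    + C (4 * p.b22 * p.r₁ + p.k22 ^ 2 * p.τ₂ - p.b22 ^ 2 * (p.Im + p.α * p.Kf) ^ 2) * X ^ 3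
    + C (4 * p.b22 * p.Kf ^ 2 * p.Im * p.κ₁
        - p.k22 ^ 2 * (p.Im + p.α * p.Kf) ^ 2) * X ^ 2

end Params

end SDEA

end

open Polynomial Filter Topology

namespace SDEA

/-! Clearing denominators at `jω` shows that the frequency polynomial at `ω²` is `c(ω)` times a
nonnegative factor (`Admissible.eval_freqPoly`). With `Bf = 0` or `b22 = 0` its leading coefficient
is negative, so `c(ω) < 0` for all large `ω`, and only finitely many `ω` are lost to roots of `den`.
This contradicts Condition (c-ii) directly. It also excludes positive realness: the power form stays
nonnegative in the limit from the right half plane to a regular point `jω`, and `c(ω)` is the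
determinant of its Hermitian part there (`TwoPortPassive.condCii_nonneg`). -/

lemma aeval_denom_tf_ne_zero {N D : ℝ[X]} {s : ℂ} (h : aeval s D ≠ 0) :
    aeval s (Params.tf N D).denom ≠ 0 := by
  obtain ⟨q, hq⟩ : (Params.tf N D).denom ∣ D := RatFunc.denom_div_dvd N D
  intro h0
  apply h
  rw [hq, map_mul, h0, zero_mul]

lemma not_isPole_tf {N D : ℝ[X]} {s : ℂ} (h : aeval s D ≠ 0) : ¬ IsPole (Params.tf N D) s :=
  aeval_denom_tf_ne_zero h

/-- Away from the roots of `D`, the transfer function `N / D` has the value `N(s) / D(s)`. -/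
lemma tfEval_tf {N D : ℝ[X]} {s : ℂ} (h : aeval s D ≠ 0) :
    tfEval (Params.tf N D) s = aeval s N / aeval s D := by
  have hD : D ≠ 0 := by rintro rfl; simp at h
  have h1 := aeval_denom_tf_ne_zero (N := N) h
  -- Cross-multiplied, the identity involves polynomials only, so it survives evaluation even if `N`
  -- and `D` share factors.
  have h2 : (Params.tf N D).num * D = N * (Params.tf N D).denom :=
    (RatFunc.num_mul_eq_mul_denom_iff hD).2 rfl
  have h3 := congrArg (aeval s) h2
  rw [map_mul, map_mul] at h3
  change aeval s (Params.tf N D).num / aeval s (Params.tf N D).denom = _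
  rw [div_eq_div_iff h1 h, h3]

lemma tfEval_neg_one (s : ℂ) : tfEval (-1) s = -1 := by
  have h := tfEval_tf (N := -1) (D := 1) (s := s) (by simp)
  simpa [Params.tf] using h

lemma not_isPole_neg_one (s : ℂ) : ¬ IsPole (-1) s := by
  have h := not_isPole_tf (N := -1) (D := 1) (s := s) (by simp)
  simpa [Params.tf] using h

/-- A Hermitian form in two variables that takes no negative value has a nonnegative
determinant. -/
lemma det_nonneg_of_form_nonneg (h : Matrix (Fin 2) (Fin 2) ℂ)
    (hn : ∀ x : Fin 2 → ℂ, 0 ≤ (∑ i, ∑ j, (starRingEnd ℂ) (x i) * h i j * x j).re) :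
    0 ≤ (h 0 0).re * (h 1 1).re - ‖((starRingEnd ℂ) (h 0 1) + h 1 0) / 2‖ ^ 2 := by
  set b : ℂ := (h 0 1 + (starRingEnd ℂ) (h 1 0)) / 2 with hb
  have hform : ∀ x y : ℂ, 0 ≤ (h 0 0).re * Complex.normSq x + (h 1 1).re * Complex.normSq y
      + 2 * ((starRingEnd ℂ) x * b * y).re := by
    intro x y
    have := hn ![x, y]
    simp only [Fin.sum_univ_two, Matrix.cons_val_zero, Matrix.cons_val_one, Complex.add_re,
      Complex.mul_re, Complex.mul_im, Complex.conj_re, Complex.conj_im] at this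
    simp [hb, Complex.normSq_apply, Complex.mul_re, Complex.mul_im]
    linarith
  have hnorm : ‖((starRingEnd ℂ) (h 0 1) + h 1 0) / 2‖ ^ 2 = b.re ^ 2 + b.im ^ 2 := by
    rw [← Complex.normSq_eq_norm_sq, Complex.normSq_apply]
    simp [hb]
    ring
  rw [hnorm]
  -- With `a`, `d` the diagonal real parts, the first two vectors give `a(ad - |b|²) ≥ 0` and `d(ad
  -- - |b|²) ≥ 0`; the third forces `b = 0` when `a = d = 0`.
  have h1 := hform (-b) ((h 0 0).re : ℂ)
  have h2 := hform ((h 1 1).re : ℂ) (-(starRingEnd ℂ) b)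
  have h3 := hform (-b) 1
  have h4 := hform 1 0
  have h5 := hform 0 1
  simp [Complex.normSq_apply] at h1 h2 h3 h4 h5
  by_contra hc
  push Not at hc
  rcases h4.eq_or_lt with ha | ha
  · rcases h5.eq_or_lt with hd | hd
    · rw [← ha, ← hd] at h3 hc
      nlinarith
    · nlinarith
  · nlinarith

/-- The value of a hybrid matrix at a frequency reached as a limit from the open right half
plane inherits the nonnegativity of the power form. -/
lemma TwoPortPassive.condCii_nonneg {H : Matrix (Fin 2) (Fin 2) (RatFunc ℝ)}
    (hH : TwoPortPassive H) {ω : ℝ} (hω : ∀ i j, ¬ IsPole (H i j) (jw ω)) :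
    0 ≤ condCii H ω := by
  refine det_nonneg_of_form_nonneg (fun i j => tfEval (H i j) (jw ω)) fun x => ?_
  have hcont : ∀ i j, ContinuousAt (tfEval (H i j)) (jw ω) := fun i j =>
    ((H i j).num.continuous_aeval (A := ℂ)).continuousAt.div
      ((H i j).denom.continuous_aeval (A := ℂ)).continuousAt (hω i j)
  have hform : ContinuousAt (fun s : ℂ =>
      (∑ i, ∑ j, (starRingEnd ℂ) (x i) * tfEval (H i j) s * x j).re) (jw ω) := by
    refine Complex.continuous_re.continuousAt.comp ?_
    simp only [Fin.sum_univ_two]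
    have := hcont 0 0
    have := hcont 0 1
    have := hcont 1 0
    have := hcont 1 1
    fun_prop
  -- Approach `jω` horizontally, through points of real part `ε > 0`.
  have hlim : Tendsto (fun ε : ℝ => jw ω + (ε : ℂ)) (𝓝[>] 0) (𝓝 (jw ω)) := by
    have : Continuous fun ε : ℝ => jw ω + (ε : ℂ) := by fun_prop
    simpa using (this.tendsto 0).mono_left nhdsWithin_le_nhds
  refine ge_of_tendsto (hform.tendsto.comp hlim) ?_
  filter_upwards [self_mem_nhdsWithin] with ε hε
  exact hH.2 _ (by simpa [jw] using hε) x

/-- A nonzero real polynomial does not vanish at `jω` for large `ω`. -/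
lemma eventually_aeval_jw_ne_zero {D : ℝ[X]} (hD : D ≠ 0) :
    ∀ᶠ ω : ℝ in atTop, aeval (jw ω) D ≠ 0 := by
  have hinj : Function.Injective jw := fun a b h => by simpa [jw] using h
  have hfin : {ω : ℝ | aeval (jw ω) D = 0}.Finite := by
    refine ((D.rootSet_finite ℂ).preimage hinj.injOn).subset fun ω h => ?_
    exact (mem_rootSet.2 ⟨hD, h⟩)
  have := hfin.isCompact.compl_mem_cocompact
  exact atTop_le_cocompact this

lemma eventually_eval_sq_neg {t : ℝ[X]} (hdeg : 0 < t.natDegree) (hlc : t.leadingCoeff < 0) :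
    ∀ᶠ ω : ℝ in atTop, t.eval (ω ^ 2) < 0 :=
  ((t.tendsto_atBot_of_leadingCoeff_nonpos (natDegree_pos_iff_degree_pos.1 hdeg) hlc.le).comp
    (tendsto_pow_atTop two_ne_zero)).eventually_lt_atBot 0

/-! ### The h-parameters on the imaginary axis -/

namespace Params

variable {p : Params}

lemma Admissible.den_ne_zero (hp : p.Admissible) : p.den ≠ 0 := by
  intro h
  have h4 : p.den.coeff 4 = p.M := by
    simp only [den, coeff_add, coeff_C_mul, coeff_X_pow, coeff_X, coeff_C]
    norm_num
  rw [h, coeff_zero] at h4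
  exact hp.M_pos.ne h4

/-- The real part at `jω` is `k22 > 0`, whatever `b22` is. -/
lemma Admissible.aeval_den22_ne_zero (hp : p.Admissible) (ω : ℝ) :
    aeval (jw ω) p.den22 ≠ 0 := by
  intro h
  have := congrArg Complex.re h
  simp [den22, jw] at this
  exact hp.k22_pos.ne' this

lemma Admissible.not_isPole_hybrid (hp : p.Admissible) {ω : ℝ} (h : aeval (jw ω) p.den ≠ 0)
    (i j : Fin 2) : ¬ IsPole (p.hybrid i j) (jw ω) := by
  fin_cases i <;> fin_cases j
  · exact not_isPole_tf h
  · exact not_isPole_tf h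
  · exact not_isPole_neg_one _
  · exact not_isPole_tf (hp.aeval_den22_ne_zero ω)

lemma aeval_den_jw (ω : ℝ) : aeval (jw ω) p.den =
    ⟨p.M * ω ^ 4 - (p.Im + p.Kf * (p.α + p.Pm * p.Pf)
        + p.Bf * p.Pm * p.Pf * (p.μ + p.ν)) * ω ^ 2 + p.Kf * p.Im * p.If,
      (p.Bf * p.Im * p.If + p.Kf * p.Pm * p.Pf * (p.μ + p.ν)) * ω
        - (p.B + p.Pm + p.Bf * (p.α + p.Pm * p.Pf)) * ω ^ 3⟩ := by
  apply Complex.ext <;> simp [den, jw, pow_succ] <;> ring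

lemma aeval_num11_jw (ω : ℝ) : aeval (jw ω) p.num11 =
    ⟨p.Bf * p.M * ω ^ 4 - (p.Bf * p.Im + p.Kf * (p.B + p.Pm)) * ω ^ 2,
      p.Kf * p.Im * ω - (p.Bf * (p.B + p.Pm) + p.Kf * p.M) * ω ^ 3⟩ := by
  apply Complex.ext <;> simp [num11, jw, pow_succ] <;> ring

lemma aeval_num12_jw (ω : ℝ) : aeval (jw ω) p.num12 =
    ⟨p.Kf * p.Im * p.If - p.Pm * p.Pf * (p.Kf + p.Bf * (p.μ + p.ν)) * ω ^ 2,
      (p.Bf * p.Im * p.If + p.Kf * p.Pm * p.Pf * (p.μ + p.ν)) * ω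
        - p.Bf * p.Pm * p.Pf * ω ^ 3⟩ := by
  apply Complex.ext <;> simp [num12, jw, pow_succ] <;> ring

lemma aeval_den22_jw (ω : ℝ) : aeval (jw ω) p.den22 = ⟨p.k22, p.b22 * ω⟩ := by
  apply Complex.ext <;> simp [den22, jw]

/-- Clearing denominators in Condition (c-ii) for `h₁₁ = n / d`, `h₁₂ = m / d`, `h₂₁ = -1`,
`h₂₂ = q / e`. -/
lemma condCii_clear_denominators (n m d q e : ℂ) (hd : d ≠ 0) (he : e ≠ 0) :
    4 * ‖d‖ ^ 2 * ‖e‖ ^ 2 * ((n / d).re * (q / e).re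
      - ‖((starRingEnd ℂ) (m / d) + -1) / 2‖ ^ 2) =
    4 * (n * (starRingEnd ℂ) d).re * (q * (starRingEnd ℂ) e).re
      - Complex.normSq (m - d) * Complex.normSq e := by
  have hre : ∀ a b : ℂ, (a / b).re = (a * (starRingEnd ℂ) b).re / ‖b‖ ^ 2 := by
    intro a b
    rw [← Complex.normSq_eq_norm_sq, Complex.div_re]
    simp
    ring
  have hdiff : ‖((starRingEnd ℂ) (m / d) + -1) / 2‖ ^ 2 = ‖m - d‖ ^ 2 / ‖d‖ ^ 2 / 4 := by
    have h1 : (starRingEnd ℂ) (m / d) + -1 = (starRingEnd ℂ) ((m - d) / d) := by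
      rw [sub_div, div_self hd]
      simp [sub_eq_add_neg]
    rw [h1, norm_div, Complex.norm_conj, norm_div, div_pow, div_pow]
    norm_num
  have hd' : ‖d‖ ≠ 0 := norm_ne_zero_iff.2 hd
  have he' : ‖e‖ ≠ 0 := norm_ne_zero_iff.2 he
  rw [hre, hre, hdiff, Complex.normSq_eq_norm_sq, Complex.normSq_eq_norm_sq]
  field_simp

theorem Admissible.eval_freqPoly (hp : p.Admissible) {ω : ℝ} (h : aeval (jw ω) p.den ≠ 0) :
    p.freqPoly.eval (ω ^ 2) =
      4 * ‖aeval (jw ω) p.den‖ ^ 2 * ‖aeval (jw ω) p.den22‖ ^ 2 * condCii p.hybrid ω := by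
  have he := hp.aeval_den22_ne_zero ω
  have hc : condCii p.hybrid ω =
      (aeval (jw ω) p.num11 / aeval (jw ω) p.den).re * (jw ω / aeval (jw ω) p.den22).re
      - ‖((starRingEnd ℂ) (aeval (jw ω) p.num12 / aeval (jw ω) p.den) + -1) / 2‖ ^ 2 := by
    have h22 := tfEval_tf (N := X) he
    rw [aeval_X] at h22
    rw [← tfEval_tf h, ← tfEval_tf h, ← h22, ← tfEval_neg_one (jw ω)]
    rfl
  rw [hc, condCii_clear_denominators _ _ _ _ _ h he, aeval_den_jw, aeval_num11_jw,
    aeval_num12_jw, aeval_den22_jw]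
  -- Taking `μ` and `ν` as the free parameters removes the divisions, so a polynomial identity
  -- remains.
  have hμ : p.Im = p.μ * p.Pm := (div_mul_cancel₀ _ hp.Pm_pos.ne').symm
  have hν : p.If = p.ν * p.Pf := (div_mul_cancel₀ _ hp.Pf_pos.ne').symm
  simp only [freqPoly, eval_add, eval_mul, eval_C, eval_pow, eval_X, Complex.normSq_apply,
    Complex.sub_re, Complex.sub_im, Complex.mul_re, Complex.conj_re, Complex.conj_im, jw,
    Complex.I_re, Complex.I_im, Complex.mul_im, Complex.ofReal_re, Complex.ofReal_im,
    r₁, r₂, τ₁, τ₂, κ₁, κ₃, κ₂]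
  rw [hμ, hν]
  ring

/-! ### Degree and sign of the frequency polynomial -/

lemma freqPoly_coeff_five : p.freqPoly.coeff 5 = p.τ₁ * p.b22 * p.M ^ 2 := by
  simp only [freqPoly, coeff_add, coeff_C_mul, coeff_X_pow]
  norm_num

lemma freqPoly_coeff_four : p.freqPoly.coeff 4 =
    4 * p.b22 * p.r₂ + p.b22 ^ 2 * p.τ₂ - p.k22 ^ 2 * p.M ^ 2 := by
  simp only [freqPoly, coeff_add, coeff_C_mul, coeff_X_pow]
  norm_num

lemma freqPoly_natDegree_le : p.freqPoly.natDegree ≤ 5 := by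
  unfold freqPoly
  compute_degree

lemma freqPoly_coeff_five_of_Bf_eq_zero (h : p.Bf = 0) :
    p.freqPoly.coeff 5 = -(p.b22 ^ 2 * p.M ^ 2) := by
  rw [freqPoly_coeff_five, τ₁, h]
  ring

theorem Admissible.freqPoly_of_Bf_eq_zero (hp : p.Admissible) (h : p.Bf = 0)
    (hb : 0 < p.b22) : p.freqPoly.natDegree = 5 ∧
      p.freqPoly.leadingCoeff = -(p.b22 ^ 2 * p.M ^ 2) ∧ p.freqPoly.leadingCoeff < 0 := by
  have hM := hp.M_pos
  have hneg : -(p.b22 ^ 2 * p.M ^ 2) < 0 := neg_neg_of_pos (by positivity)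
  have h5 := freqPoly_coeff_five_of_Bf_eq_zero h
  have hdeg : p.freqPoly.natDegree = 5 :=
    natDegree_eq_of_le_of_coeff_ne_zero freqPoly_natDegree_le (h5 ▸ hneg.ne)
  have hlc : p.freqPoly.leadingCoeff = -(p.b22 ^ 2 * p.M ^ 2) := by
    rw [leadingCoeff, hdeg, h5]
  exact ⟨hdeg, hlc, hlc ▸ hneg⟩

theorem Admissible.freqPoly_of_b22_eq_zero (hp : p.Admissible) (h : p.b22 = 0) :
    p.freqPoly.natDegree = 4 ∧
      p.freqPoly.leadingCoeff = -(p.k22 ^ 2 * p.M ^ 2) ∧ p.freqPoly.leadingCoeff < 0 := by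
  have hM := hp.M_pos
  have hk := hp.k22_pos
  have hneg : -(p.k22 ^ 2 * p.M ^ 2) < 0 := neg_neg_of_pos (by positivity)
  have h4 : p.freqPoly.coeff 4 = -(p.k22 ^ 2 * p.M ^ 2) := by
    rw [freqPoly_coeff_four, h]
    ring
  have hle : p.freqPoly.natDegree ≤ 4 := by
    simp only [freqPoly, h, mul_zero, zero_mul, map_zero, zero_add]
    compute_degree
  have hdeg : p.freqPoly.natDegree = 4 :=
    natDegree_eq_of_le_of_coeff_ne_zero hle (h4 ▸ hneg.ne)
  have hlc : p.freqPoly.leadingCoeff = -(p.k22 ^ 2 * p.M ^ 2) := by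
    rw [leadingCoeff, hdeg, h4]
  exact ⟨hdeg, hlc, hlc ▸ hneg⟩

/-- Without physical or without virtual damping, Condition (c-ii) fails at high frequency. -/
theorem Admissible.eventually_condCii_neg (hp : p.Admissible) (h : p.Bf = 0 ∨ p.b22 = 0) :
    ∀ᶠ ω : ℝ in atTop,
      (∀ i j, ¬ IsPole (p.hybrid i j) (jw ω)) ∧ condCii p.hybrid ω < 0 := by
  have ht : 0 < p.freqPoly.natDegree ∧ p.freqPoly.leadingCoeff < 0 := by
    -- Splitting on `b22` first also covers `Bf = b22 = 0`, where the degree is 4, not 5.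
    rcases hp.b22_nonneg.eq_or_lt with hb | hb
    · obtain ⟨h1, -, h2⟩ := hp.freqPoly_of_b22_eq_zero hb.symm
      exact ⟨by omega, h2⟩
    · obtain ⟨h1, -, h2⟩ := hp.freqPoly_of_Bf_eq_zero (h.resolve_right hb.ne') hb
      exact ⟨by omega, h2⟩
  filter_upwards [eventually_aeval_jw_ne_zero hp.den_ne_zero,
    eventually_eval_sq_neg ht.1 ht.2] with ω hω hneg
  refine ⟨hp.not_isPole_hybrid hω, ?_⟩
  rw [hp.eval_freqPoly hω] at hneg
  -- Nonnegativity of the factor suffices: `c(ω) ≥ 0` would make the product nonnegative.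
  by_contra! hc
  exact hneg.not_ge (by positivity)

end Params

end SDEA

/-- Necessity of the physical damping `Bf` and of the virtual damping `b22`. -/
theorem mainTheorem2 (p : SDEA.Params) (hp : p.Admissible) :
    -- two-port passivity fails without physical damping, and without virtual damping
    ((p.Bf = 0 ∨ p.b22 = 0) →
      ¬ SDEA.TwoPortPassive p.hybrid ∧
      ¬ SDEA.TwoPortPassivityCriterion p.hybrid ∧
      (∀ᶠ ω : ℝ in Filter.atTop,
        (∀ i j, ¬ SDEA.IsPole (p.hybrid i j) (SDEA.jw ω)) ∧ SDEA.condCii p.hybrid ω < 0)) ∧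
    -- `freqPoly` is the frequency polynomial of Condition (c-ii)
    (∀ ω : ℝ, Polynomial.aeval (SDEA.jw ω) p.den ≠ 0 →
      p.freqPoly.eval (ω ^ 2) =
        4 * ‖Polynomial.aeval (SDEA.jw ω) p.den‖ ^ 2 *
          ‖Polynomial.aeval (SDEA.jw ω) p.den22‖ ^ 2 * SDEA.condCii p.hybrid ω) ∧
    -- its leading coefficient without physical damping
    (p.Bf = 0 → p.freqPoly.coeff 5 = -(p.b22 ^ 2 * p.M ^ 2)) ∧
    (p.Bf = 0 → 0 < p.b22 →
      p.freqPoly.natDegree = 5 ∧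
      p.freqPoly.leadingCoeff = -(p.b22 ^ 2 * p.M ^ 2) ∧ p.freqPoly.leadingCoeff < 0) ∧
    -- its leading coefficient without virtual damping
    (p.b22 = 0 →
      p.freqPoly.natDegree = 4 ∧
      p.freqPoly.leadingCoeff = -(p.k22 ^ 2 * p.M ^ 2) ∧ p.freqPoly.leadingCoeff < 0) := by
  refine ⟨fun h => ?_, fun ω hω => hp.eval_freqPoly hω,
    SDEA.Params.freqPoly_coeff_five_of_Bf_eq_zero, hp.freqPoly_of_Bf_eq_zero,
    hp.freqPoly_of_b22_eq_zero⟩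
  have hev := hp.eventually_condCii_neg h
  obtain ⟨ω, hpole, hneg⟩ := hev.exists
  exact ⟨fun hH => hneg.not_ge (hH.condCii_nonneg hpole),
    fun hH => hneg.not_ge (hH.condCii ω hpole), hev⟩
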